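/- For metric spaces $(M,d_M)$, $(N,d_N)$ and $\alpha\ge 1$, say that $M$ embeds with distortion $\alpha$ into $N$ if there are $f:M\to N$ and $\tau>0$ such that $\tau d_M(x,y)\le d_N(f(x),f(y))\le \alpha\tau d_M(x,y)$ for all $x,y\in M$. For $n\in\mathbb N$ and a real normed space $X$, let $\mathsf k_n^\alpha(X)$ be the minimum $k\in\mathbb N$ such that every $n$-point subset of $X$ embeds with distortion $\alpha$ into some $k$-dimensional linear subspace of $X$. Let $\ell_\infty$ be the space of bounded real sequences with the supremum norm. Then the following hold. 1. There is a universal constant $c_0>0$ such that for every integer $n\ge 2$ and every $\alpha\ge 1$, the number $k=\mathsf k_n^\alpha(\ell_\infty)$ satisfies $$\alpha\log(k+1)\ \ge\ c_0\, n^{\frac{1}{2k}}\log n .$$ 2. There are universal constants $c,\kappa>0$ such that for every integer $n\ge 20$ and every $\alpha\ge 2$, $$\mathsf k_n^\alpha(\ell_\infty)\ \ge\ \kappa\left(n^{\frac{c}{\alpha}}+\frac{\log n}{\log\left(\frac{\log n}{\alpha}+\frac{\alpha\log\log n}{\log n}\right)}\right).$$ 3. In particular, if $\alpha\asymp\log n$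 then $\mathsf k_n^\alpha(\ell_\infty)\gtrsim \frac{\log n}{\log\log\log n}$. That is, for all $0<a\le b$ there is $\kappa=\kappa(a,b)>0$ such that for every integer $n\ge 20$ and every $\alpha\ge 1$ with $a\log n\le\alpha\le b\log n$, $$\mathsf k_n^\alpha(\ell_\infty)\ \ge\ \kappa\,\frac{\log n}{\log\log\log n}.$$ -/

import Mathlib

/-- The metric space `M` embeds with distortion `α` into the metric space `N`: there are a map
`f : M → N` and a scaling factor `τ > 0` such that
`τ d(x, y) ≤ d(f x, f y) ≤ α τ d(x, y)` for all `x, y`. -/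
def EmbedsWithDistortion (M N : Type*) [MetricSpace M] [MetricSpace N] (α : ℝ) : Prop :=
  ∃ (f : M → N) (τ : ℝ), 0 < τ ∧
    ∀ x y : M, τ * dist x y ≤ dist (f x) (f y) ∧ dist (f x) (f y) ≤ α * τ * dist x y

/-- Every `n`-point subset of `X` embeds with distortion `α` into some `k`-dimensional linear
subspace of `X` (the subspace may depend on the subset). -/
def HasDimReduction (X : Type*) [NormedAddCommGroup X] [NormedSpace ℝ X]
    (n : ℕ) (α : ℝ) (k : ℕ) : Prop :=
  ∀ C : Finset X, C.card = n →
    ∃ F : Submodule ℝ X, FiniteDimensional ℝ F ∧ Module.finrank ℝ F = k ∧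
      EmbedsWithDistortion C F α

/-- The metric dimension reduction modulus `k_n^α(X)`: the minimum `k` such that every `n`-point
subset of `X` embeds with distortion `α` into some `k`-dimensional linear subspace of `X`. -/
noncomputable def dimReductionModulus (X : Type*) [NormedAddCommGroup X] [NormedSpace ℝ X]
    (n : ℕ) (α : ℝ) : ℕ :=
  sInf {k : ℕ | HasDimReduction X n α k}

/-- The Banach space `ℓ_∞` of bounded real sequences with the supremum norm. -/
abbrev EllInfty : Type := lp (fun _ : ℕ => ℝ) (⊤ : ENNReal)

/-! Every finite metric space embeds isometrically into `EllInfty`, so one badly embeddable space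
suffices. It is the Cayley graph of `F₂^(40q)`, with `q ≍ log n`, whose generators come from a
linear code of positive rate and relative distance. It has two properties: its lazy walk has a
spectral gap (`hasLazyGap_of_weight`), and balls of radius `q` contain at most `2^(15q)` points
(`card_codeLength_le_mul_pow_le`).

Let `f` embed it with distortion `α` into a `k`-dimensional normed space. In Auerbach coordinates
the norm is Euclidean up to a factor polynomial in `k`, so `t ≍ log(k+1)` steps of the walk flatten
the centred `f`, while each step moves it by at most the edge length `ατ`. This is the Poincaré
inequality `HasLazyGap.sum_norm_sq_le`. Half of the vertices therefore land in a ball of radius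
`4tατ`; among them are `2^(25q-1)` points that are pairwise more than `q` apart. Comparing volumes
gives `n^(1/(2k)) ≲ tα/q`, which is the first inequality.

Bounding `n^(1/(2k))` below by `1` gives the term `n^(c/α)`. The logarithmic term follows by
contradiction in `exists_const_div_log_le`, and when `α ≍ log n` its denominator is `O(log log log
n)`. -/

open Module Finset

/-! ### Auerbach bases -/

/-- **Auerbach's lemma**: a finite-dimensional normed space has a basis of vectors of norm at most
one whose coordinate functionals have norm at most one. -/
theorem exists_auerbach_basis (F : Type*) [NormedAddCommGroup F] [NormedSpace ℝ F]
    [FiniteDimensional ℝ F] :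
    ∃ e : Basis (Fin (finrank ℝ F)) ℝ F, (∀ i, ‖e i‖ ≤ 1) ∧ ∀ i x, |e.coord i x| ≤ ‖x‖ := by
  set k := finrank ℝ F
  let b : Basis (Fin k) ℝ F := finBasis ℝ F
  have hcont : Continuous fun v : Fin k → F => |b.det v| := by
    simp only [Basis.det_apply]
    refine (Continuous.matrix_det (continuous_matrix fun i j => ?_)).abs
    exact ((b.coord i).continuous_of_finiteDimensional).comp (continuous_apply j)
  have hcomp : IsCompact (Set.univ.pi fun _ : Fin k => Metric.closedBall (0 : F) 1) :=
    isCompact_univ_pi fun _ => isCompact_closedBall _ _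
  -- Maximise the volume `|det|` over the product of unit balls: replacing `v i` by a unit-ball
  -- vector `y` multiplies the determinant by the `i`-th coordinate of `y`, which maximality bounds
  -- by `1`.
  obtain ⟨v, hv, hmax⟩ := hcomp.exists_isMaxOn
    ⟨0, fun i _ => by simp⟩ hcont.continuousOn
  have hv1 : ∀ i, ‖v i‖ ≤ 1 := fun i => by simpa using hv i (Set.mem_univ i)
  have hdet : 0 < |b.det v| := by
    have h1 : (fun i => (‖b i‖⁻¹ : ℝ) • b i) ∈
        Set.univ.pi fun _ : Fin k => Metric.closedBall (0 : F) 1 := fun i _ => by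
      simp [norm_smul, inv_mul_cancel₀ (norm_ne_zero_iff.2 (b.ne_zero i))]
    refine lt_of_lt_of_le ?_ (hmax h1)
    have h2 := b.det.toMultilinearMap.map_smul_univ (fun i => (‖b i‖⁻¹ : ℝ)) b
    change 0 < |b.det fun i => (‖b i‖⁻¹ : ℝ) • b i|
    rw [AlternatingMap.coe_multilinearMap] at h2
    rw [h2, b.det_self, abs_pos]
    simp [prod_eq_zero_iff, b.ne_zero]
  obtain ⟨hli, hsp⟩ := (Basis.is_basis_iff_det b).2 (IsUnit.mk0 _ (abs_pos.1 hdet))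
  refine ⟨Basis.mk hli hsp.ge, fun i => by simpa using hv1 i, fun i x => ?_⟩
  have key : ∀ y : F, ‖y‖ ≤ 1 → |(Basis.mk hli hsp.ge).coord i y| ≤ 1 := by
    intro y hy
    have h1 : Function.update v i y ∈
        Set.univ.pi fun _ : Fin k => Metric.closedBall (0 : F) 1 := fun j _ => by
      rcases eq_or_ne j i with rfl | h
      · simpa using hy
      · simpa [h] using hv1 j
    have h2 := LinearMap.congr_fun (b.det_smul_mk_coord_eq_det_update hli hsp.ge i) y
    have h3 : |b.det (Function.update v i y)| ≤ |b.det v| := hmax h1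
    simp only [LinearMap.smul_apply, smul_eq_mul, MultilinearMap.toLinearMap_apply,
      AlternatingMap.coe_multilinearMap] at h2
    rw [← h2, abs_mul] at h3
    exact (mul_le_iff_le_one_right hdet).1 h3
  rcases eq_or_ne x 0 with rfl | hx
  · rw [map_zero, abs_zero, norm_zero]
  · have hx' : 0 < ‖x‖ := norm_pos_iff.2 hx
    have := key (‖x‖⁻¹ • x) (by simp [norm_smul, hx'.ne'])
    rw [map_smul, smul_eq_mul, abs_mul, abs_inv, abs_norm, inv_mul_le_iff₀ hx', mul_one] at this
    exact this

/-! ### Lazy walks and the Poincaré inequality -/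

/-- One step of the lazy walk with steps `g`, acting on vector-valued functions. -/
noncomputable def lazyWalk {V ι E : Type*} [Fintype ι] [Add V] [AddCommGroup E] [Module ℝ E]
    (g : ι → V) (f : V → E) : V → E :=
  fun x => (1 / 2 : ℝ) • f x + (1 / (2 * (Fintype.card ι : ℝ))) • ∑ i, f (x + g i)

section LazyWalk

variable {V ι E : Type*} [Fintype ι] [AddCommGroup V] (g : ι → V)

theorem lazyWalk_comp [AddCommGroup E] [Module ℝ E] (φ : E →ₗ[ℝ] ℝ) (f : V → E) :
    (fun x => φ (lazyWalk g f x)) = lazyWalk g fun x => φ (f x) := by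
  funext x
  simp [lazyWalk]

theorem lazyWalk_iterate_comp [AddCommGroup E] [Module ℝ E] (φ : E →ₗ[ℝ] ℝ) (f : V → E) (t : ℕ) :
    (fun x => φ ((lazyWalk g)^[t] f x)) = (lazyWalk g)^[t] fun x => φ (f x) := by
  induction t with
  | zero => rfl
  | succ t ih =>
    rw [Function.iterate_succ_apply', Function.iterate_succ_apply', ← ih, ← lazyWalk_comp]

theorem lazyWalk_sub [AddCommGroup E] [Module ℝ E] (f h : V → E) :
    lazyWalk g f - lazyWalk g h = lazyWalk g (f - h) := by
  funext x
  simp only [lazyWalk, Pi.sub_apply, sum_sub_distrib, smul_sub]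
  abel

theorem sum_lazyWalk [Fintype V] [Nonempty ι] [AddCommGroup E] [Module ℝ E] (f : V → E) :
    ∑ x, lazyWalk g f x = ∑ x, f x := by
  have h : ∀ i, ∑ x, f (x + g i) = ∑ x, f x := fun i =>
    Equiv.sum_comp (Equiv.addRight (g i)) f
  have hc : (Fintype.card ι : ℝ) ≠ 0 := by simp
  simp only [lazyWalk, sum_add_distrib, ← smul_sum]
  rw [sum_comm, sum_congr rfl fun i _ => h i, sum_const, card_univ, ← Nat.cast_smul_eq_nsmul ℝ,
    smul_smul, ← add_smul]
  convert one_smul ℝ _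
  field_simp
  norm_num

variable [Nonempty ι] [NormedAddCommGroup E] [NormedSpace ℝ E]

theorem norm_lazyWalk_le {f : V → E} {L : ℝ} (hf : ∀ x, ‖f x‖ ≤ L) (x : V) :
    ‖lazyWalk g f x‖ ≤ L := by
  have hc : (0 : ℝ) < Fintype.card ι := by exact_mod_cast Fintype.card_pos
  calc ‖lazyWalk g f x‖
      ≤ (1 / 2) * ‖f x‖ + (1 / (2 * (Fintype.card ι : ℝ))) * ‖∑ i, f (x + g i)‖ := by
        refine (norm_add_le _ _).trans_eq ?_
        rw [norm_smul, norm_smul, Real.norm_of_nonneg (by positivity),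
          Real.norm_of_nonneg (by positivity)]
    _ ≤ (1 / 2) * L + (1 / (2 * (Fintype.card ι : ℝ))) * (Fintype.card ι * L) := by
        gcongr
        · exact hf x
        · refine (norm_sum_le _ _).trans ((sum_le_sum fun i _ => hf _).trans_eq ?_)
          simp
    _ = L := by field_simp; ring

theorem norm_sub_lazyWalk_le {f : V → E} {L : ℝ} (hL : 0 ≤ L)
    (hf : ∀ x i, ‖f x - f (x + g i)‖ ≤ L) (x : V) : ‖f x - lazyWalk g f x‖ ≤ L := by
  have hc : (0 : ℝ) < Fintype.card ι := by exact_mod_cast Fintype.card_pos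
  have : f x - lazyWalk g f x = (1 / (2 * (Fintype.card ι : ℝ))) • ∑ i, (f x - f (x + g i)) := by
    rw [sum_sub_distrib, sum_const, card_univ, ← Nat.cast_smul_eq_nsmul ℝ, smul_sub, smul_smul,
      lazyWalk, ← sub_sub]
    congr 1
    have : (1 / (2 * (Fintype.card ι : ℝ))) * Fintype.card ι = 1 - 1 / 2 := by
      field_simp; norm_num
    rw [this, sub_smul, one_smul]
  rw [this, norm_smul, Real.norm_of_nonneg (by positivity)]
  calc (1 / (2 * (Fintype.card ι : ℝ))) * ‖∑ i, (f x - f (x + g i))‖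
      ≤ (1 / (2 * (Fintype.card ι : ℝ))) * (Fintype.card ι * L) := by
        gcongr
        refine (norm_sum_le _ _).trans ((sum_le_sum fun i _ => hf x i).trans_eq ?_)
        simp
    _ = L / 2 := by field_simp
    _ ≤ L := by linarith

/-- Telescoping: consecutive iterates differ by an iterate of `f - lazyWalk g f`, and averaging
never increases a uniform bound. No dimension enters. -/
theorem norm_sub_lazyWalk_iterate_le {f : V → E} {L : ℝ} (hL : 0 ≤ L)
    (hf : ∀ x i, ‖f x - f (x + g i)‖ ≤ L) (t : ℕ) (x : V) :
    ‖f x - (lazyWalk g)^[t] f x‖ ≤ t * L := by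
  have step : ∀ (t : ℕ) (x : V), ‖(lazyWalk g)^[t] (f - lazyWalk g f) x‖ ≤ L := by
    intro t
    induction t with
    | zero => exact norm_sub_lazyWalk_le g hL hf
    | succ t ih => rw [Function.iterate_succ_apply']; exact norm_lazyWalk_le g ih
  have hsub : ∀ t : ℕ, (lazyWalk g)^[t] (f - lazyWalk g f) =
      (lazyWalk g)^[t] f - (lazyWalk g)^[t + 1] f := by
    intro t
    induction t with
    | zero => rfl
    | succ t ih => rw [Function.iterate_succ_apply', ih, ← lazyWalk_sub,
        ← Function.iterate_succ_apply' (lazyWalk g), ← Function.iterate_succ_apply' (lazyWalk g)]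
  induction t with
  | zero => simp
  | succ t ih =>
    have h := step t x
    rw [hsub] at h
    calc ‖f x - (lazyWalk g)^[t + 1] f x‖
        = ‖(f x - (lazyWalk g)^[t] f x) +
            ((lazyWalk g)^[t] f x - (lazyWalk g)^[t + 1] f x)‖ := by congr 1; abel
      _ ≤ t * L + L := (norm_add_le _ _).trans (add_le_add ih h)
      _ = (t + 1 : ℕ) * L := by push_cast; ring

/-- The lazy walk with steps `g` contracts mean-zero real functions by the factor `lam` in `ℓ₂`. -/
def HasLazyGap [Fintype V] (lam : ℝ) : Prop :=
  ∀ h : V → ℝ, ∑ x, h x = 0 → ∑ x, lazyWalk g h x ^ 2 ≤ lam ^ 2 * ∑ x, h x ^ 2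

theorem HasLazyGap.iterate [Fintype V] {g : ι → V} {lam : ℝ} (hg : HasLazyGap g lam) {h : V → ℝ}
    (hh : ∑ x, h x = 0) (t : ℕ) :
    ∑ x, (lazyWalk g)^[t] h x ^ 2 ≤ lam ^ (2 * t) * ∑ x, h x ^ 2 := by
  have hz : ∀ t : ℕ, ∑ x, (lazyWalk g)^[t] h x = 0 := by
    intro t
    induction t with
    | zero => exact hh
    | succ t ih => rw [Function.iterate_succ_apply', sum_lazyWalk, ih]
  induction t with
  | zero => simp
  | succ t ih =>
    rw [Function.iterate_succ_apply']
    refine (hg _ (hz t)).trans ((mul_le_mul_of_nonneg_left ih (sq_nonneg _)).trans_eq ?_)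
    ring

/-- A Poincaré inequality for maps of a spectral expander into a finite-dimensional normed space,
in which the dimension enters only through the number of steps `t`. -/
theorem HasLazyGap.sum_norm_sq_le [Fintype V] {g : ι → V} {lam : ℝ} (hg : HasLazyGap g lam)
    [FiniteDimensional ℝ E] {f : V → E} {L : ℝ} (hL : 0 ≤ L)
    (hf : ∀ x i, ‖f x - f (x + g i)‖ ≤ L) (h0 : ∑ x, f x = 0) {t : ℕ}
    (ht : 4 * (finrank ℝ E : ℝ) ^ 2 * lam ^ (2 * t) ≤ 1) :
    ∑ x, ‖f x‖ ^ 2 ≤ 4 * Fintype.card V * (t * L) ^ 2 := by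
  obtain ⟨e, he, hφ⟩ := exists_auerbach_basis E
  generalize finrank ℝ E = k at e he hφ ht
  set A := (lazyWalk g)^[t] f
  -- Cauchy–Schwarz costs one factor `k`; summing over the `k` coordinates in `hsum` costs the
  -- other, whence the `k ^ 2` in `ht`.
  have hA : ∀ x, ‖A x‖ ^ 2 ≤ k * ∑ i, (e.coord i (A x)) ^ 2 := by
    intro x
    have h1 : ‖A x‖ ≤ ∑ i, |e.coord i (A x)| := by
      conv_lhs => rw [← e.sum_repr (A x)]
      refine (norm_sum_le _ _).trans (sum_le_sum fun i _ => ?_)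
      rw [norm_smul]
      exact mul_le_of_le_one_right (abs_nonneg _) (he i)
    calc ‖A x‖ ^ 2 ≤ (∑ i, |e.coord i (A x)|) ^ 2 := by gcongr
      _ ≤ k * ∑ i, |e.coord i (A x)| ^ 2 := by
        simpa using sq_sum_le_card_mul_sum_sq (s := univ) (f := fun i => |e.coord i (A x)|)
      _ = _ := by simp only [sq_abs]
  have hcoord : ∀ i, ∑ x, (e.coord i (A x)) ^ 2 ≤ lam ^ (2 * t) * ∑ x, ‖f x‖ ^ 2 := by
    intro i
    have h1 := congrFun (lazyWalk_iterate_comp g (e.coord i) f t)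
    have h2 : ∑ x, e.coord i (f x) = 0 := by rw [← map_sum, h0, map_zero]
    calc ∑ x, (e.coord i (A x)) ^ 2 = ∑ x, ((lazyWalk g)^[t] fun x => e.coord i (f x)) x ^ 2 :=
          sum_congr rfl fun x _ => by rw [← h1 x]
      _ ≤ lam ^ (2 * t) * ∑ x, (e.coord i (f x)) ^ 2 := hg.iterate h2 t
      _ ≤ _ := by
        refine mul_le_mul_of_nonneg_left (sum_le_sum fun x _ => ?_) (by rw [pow_mul]; positivity)
        rw [← sq_abs]
        gcongr
        exact hφ i _
  have hsum : ∑ x, ‖A x‖ ^ 2 ≤ (1 / 4) * ∑ x, ‖f x‖ ^ 2 := by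
    calc ∑ x, ‖A x‖ ^ 2 ≤ ∑ x, k * ∑ i, (e.coord i (A x)) ^ 2 := sum_le_sum fun x _ => hA x
      _ = k * ∑ i, ∑ x, (e.coord i (A x)) ^ 2 := by rw [← mul_sum, sum_comm]
      _ ≤ k * ∑ _i : Fin k, lam ^ (2 * t) * ∑ x, ‖f x‖ ^ 2 := by gcongr with i; exact hcoord i
      _ = (1 / 4) * (4 * k ^ 2 * lam ^ (2 * t)) * ∑ x, ‖f x‖ ^ 2 := by simp; ring
      _ ≤ (1 / 4) * 1 * ∑ x, ‖f x‖ ^ 2 := by gcongr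
      _ = _ := by ring
  have hpt : ∀ x, ‖f x‖ ^ 2 ≤ 2 * (t * L) ^ 2 + 2 * ‖A x‖ ^ 2 := by
    intro x
    have h1 := norm_sub_lazyWalk_iterate_le g hL hf t x
    have h2 : ‖f x‖ ≤ t * L + ‖A x‖ := by
      have := norm_add_le (f x - A x) (A x)
      rw [sub_add_cancel] at this
      linarith
    have h3 := norm_nonneg (f x)
    nlinarith [sq_nonneg (t * L - ‖A x‖)]
  have htot := sum_le_sum fun x (_ : x ∈ (univ : Finset V)) => hpt x
  rw [sum_add_distrib, ← mul_sum univ (fun x => ‖A x‖ ^ 2), sum_const, card_univ,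
    nsmul_eq_mul] at htot
  -- The smoothed part contributes at most half of `∑ ‖f x‖ ^ 2` and is absorbed on the left.
  linarith

end LazyWalk

/-! ### Walsh analysis and linear codes -/

/-- The nontrivial real character of `ZMod 2`. -/
noncomputable def sgn (z : ZMod 2) : ℝ := if z = 0 then 1 else -1

theorem sgn_add (z w : ZMod 2) : sgn (z + w) = sgn z * sgn w := by
  have h : ∀ z : ZMod 2, z = 0 ∨ z = 1 := by decide
  have h2 : (1 : ZMod 2) + 1 = 0 := by decide
  rcases h z with rfl | rfl <;> rcases h w with rfl | rfl <;> simp [sgn, h2]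

theorem sgn_eq (z : ZMod 2) : sgn z = 1 - 2 * (if z ≠ 0 then 1 else 0) := by
  by_cases h : z = 0 <;> simp [sgn, h]; norm_num

section Cube

variable {κ : Type*}

theorem cube_add_self (x : κ → ZMod 2) : x + x = 0 := by
  funext i
  exact CharTwo.add_self_eq_zero (x i)

theorem cube_neg (x : κ → ZMod 2) : -x = x := by
  rw [neg_eq_iff_add_eq_zero, cube_add_self]

variable [Fintype κ] [DecidableEq κ]

/-- Translating `a` by a basis vector at a nonzero coordinate of `x` flips every sign. -/
theorem sum_sgn_dotProduct {x : κ → ZMod 2} (hx : x ≠ 0) :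
    ∑ a : κ → ZMod 2, sgn (a ⬝ᵥ x) = 0 := by
  obtain ⟨i, hi⟩ := Function.ne_iff.1 hx
  have h : ∀ a : κ → ZMod 2, sgn ((a + Pi.single i 1) ⬝ᵥ x) = -sgn (a ⬝ᵥ x) := by
    intro a
    rw [add_dotProduct, sgn_add, single_one_dotProduct, show sgn (x i) = -1 from if_neg hi]
    ring
  have h2 := Equiv.sum_comp (Equiv.addRight (Pi.single i (1 : ZMod 2)))
    fun a : κ → ZMod 2 => sgn (a ⬝ᵥ x)
  simp only [Equiv.coe_addRight, h, sum_neg_distrib] at h2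
  linarith

/-- The Walsh transform of a real function on the cube. -/
noncomputable def walsh (h : (κ → ZMod 2) → ℝ) (a : κ → ZMod 2) : ℝ :=
  ∑ x, sgn (a ⬝ᵥ x) * h x

/-- Parseval, from orthogonality of characters. -/
theorem sum_walsh_sq (h : (κ → ZMod 2) → ℝ) :
    ∑ a, walsh h a ^ 2 = Fintype.card (κ → ZMod 2) * ∑ x, h x ^ 2 := by
  have h1 : ∀ x y : κ → ZMod 2, ∑ a : κ → ZMod 2, sgn (a ⬝ᵥ x) * sgn (a ⬝ᵥ y) =
      if x = y then (Fintype.card (κ → ZMod 2) : ℝ) else 0 := by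
    intro x y
    simp only [← sgn_add, ← dotProduct_add]
    split_ifs with hxy
    · subst hxy
      simp [cube_add_self, sgn]
    · refine sum_sgn_dotProduct fun h0 => hxy ?_
      rw [add_eq_zero_iff_eq_neg] at h0
      rw [h0, cube_neg]
  calc ∑ a, walsh h a ^ 2
      = ∑ a : κ → ZMod 2, ∑ x, ∑ y, h x * h y * (sgn (a ⬝ᵥ x) * sgn (a ⬝ᵥ y)) := by
        refine sum_congr rfl fun a _ => ?_
        rw [walsh, sq, sum_mul_sum]
        exact sum_congr rfl fun x _ => sum_congr rfl fun y _ => by ring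
    _ = ∑ x, ∑ y, h x * h y * ∑ a : κ → ZMod 2, sgn (a ⬝ᵥ x) * sgn (a ⬝ᵥ y) := by
        rw [sum_comm]
        refine sum_congr rfl fun x _ => ?_
        rw [sum_comm]
        exact sum_congr rfl fun y _ => by rw [mul_sum]
    _ = _ := by
        simp only [h1, mul_ite, mul_zero, sum_ite_eq, mem_univ, if_true]
        rw [mul_sum]
        exact sum_congr rfl fun x _ => by ring

/-- Characters diagonalise the walk, since it commutes with translations. -/
theorem walsh_lazyWalk {ι : Type*} [Fintype ι] (g : ι → κ → ZMod 2) (h : (κ → ZMod 2) → ℝ)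
    (a : κ → ZMod 2) :
    walsh (lazyWalk g h) a =
      (1 / 2 + 1 / (2 * (Fintype.card ι : ℝ)) * ∑ i, sgn (a ⬝ᵥ g i)) * walsh h a := by
  have hshift : ∀ i, ∑ x, sgn (a ⬝ᵥ x) * h (x + g i) = sgn (a ⬝ᵥ g i) * walsh h a := by
    intro i
    rw [walsh, mul_sum]
    refine Fintype.sum_equiv (Equiv.addRight (g i)) _ _ fun x => ?_
    rw [Equiv.coe_addRight, dotProduct_add, sgn_add]
    have : sgn (a ⬝ᵥ g i) * sgn (a ⬝ᵥ g i) = 1 := by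
      rw [← sgn_add, CharTwo.add_self_eq_zero]; simp [sgn]
    linear_combination (-(sgn (a ⬝ᵥ x) * h (x + g i))) * this
  calc walsh (lazyWalk g h) a
      = 1 / 2 * walsh h a + 1 / (2 * (Fintype.card ι : ℝ)) *
          ∑ i, ∑ x, sgn (a ⬝ᵥ x) * h (x + g i) := by
        rw [sum_comm, mul_sum, walsh, walsh, mul_sum, ← sum_add_distrib]
        refine sum_congr rfl fun x _ => ?_
        rw [← mul_sum, lazyWalk, smul_eq_mul, smul_eq_mul]
        ring
    _ = _ := by
        rw [sum_congr rfl fun i _ => hshift i, ← sum_mul]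
        ring

/-- A lower bound on the weights of the code with generators `g` gives a spectral gap. -/
theorem hasLazyGap_of_weight {ι : Type*} [Fintype ι] [Nonempty ι] (g : ι → κ → ZMod 2) {δ : ℝ}
    (hg : ∀ a ≠ 0, δ * Fintype.card ι ≤ #{i | a ⬝ᵥ g i ≠ 0}) : HasLazyGap g (1 - δ) := by
  intro h h0
  have hc : (0 : ℝ) < Fintype.card ι := by exact_mod_cast Fintype.card_pos
  have hV : (0 : ℝ) < Fintype.card (κ → ZMod 2) := by exact_mod_cast Fintype.card_pos
  have hw0 : walsh h 0 = 0 := by simpa [walsh, sgn] using h0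
  refine le_of_mul_le_mul_left ?_ hV
  rw [← sum_walsh_sq, mul_left_comm, ← sum_walsh_sq, mul_sum]
  refine sum_le_sum fun a _ => ?_
  rw [walsh_lazyWalk, mul_pow]
  rcases eq_or_ne a 0 with rfl | ha
  · simp [hw0]
  have h1 : ∑ i, sgn (a ⬝ᵥ g i) = Fintype.card ι - 2 * #{i | a ⬝ᵥ g i ≠ 0} := by
    simp only [sgn_eq, sum_sub_distrib, ← mul_sum, sum_boole]
    simp
  have h2 : (#{i | a ⬝ᵥ g i ≠ 0} : ℝ) ≤ Fintype.card ι := by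
    exact_mod_cast (card_le_univ _)
  rw [h1]
  -- Laziness makes the multiplier one minus the relative weight, hence nonnegative, so a lower
  -- bound on weights alone bounds its square.
  have h3 : 1 / 2 + 1 / (2 * (Fintype.card ι : ℝ)) *
      (Fintype.card ι - 2 * #{i | a ⬝ᵥ g i ≠ 0}) =
      1 - #{i | a ⬝ᵥ g i ≠ 0} / (Fintype.card ι : ℝ) := by
    field_simp; ring
  rw [h3]
  have h4 : (#{i | a ⬝ᵥ g i ≠ 0} : ℝ) / Fintype.card ι ≤ 1 := (div_le_one hc).2 h2
  have h5 : δ ≤ (#{i | a ⬝ᵥ g i ≠ 0} : ℝ) / Fintype.card ι := (le_div_iff₀ hc).2 (hg a ha)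
  gcongr

/-- Existence of linear codes of positive rate and relative distance, by averaging. -/
theorem exists_generators (m : ℕ) (hκ : Fintype.card κ = m) :
    ∃ g : Fin (4 * m) → κ → ZMod 2, ∀ a ≠ 0, m ≤ 2 * #{i | a ⬝ᵥ g i ≠ 0} := by
  -- Exponential moment: for random `g` and fixed `a ≠ 0`, the product of the `w` values is `4` to
  -- minus the weight and has mean `(5/8)^(4m)`. Summing over all `a` works because `2 * (5/8)^4 ≤
  -- 1/2`.
  let w : ZMod 2 → ℝ := fun z => if z ≠ 0 then 1 / 4 else 1
  have hw : ∀ z, w z = 5 / 8 + 3 / 8 * sgn z := fun z => by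
    by_cases h : z = 0 <;> simp [w, sgn, h] <;> norm_num
  have hcard : Fintype.card (κ → ZMod 2) = 2 ^ m := by simp [ZMod.card, hκ]
  have hwsum : ∀ a : κ → ZMod 2, a ≠ 0 → ∑ x, w (a ⬝ᵥ x) = 5 / 8 * 2 ^ m := by
    intro a ha
    simp only [hw, sum_add_distrib, ← mul_sum, dotProduct_comm a]
    rw [sum_sgn_dotProduct ha, sum_const, card_univ, hcard]
    simp [mul_comm]
  have htotal : ∑ g : Fin (4 * m) → κ → ZMod 2,
      ∑ a with a ≠ (0 : κ → ZMod 2), ∏ i, w (a ⬝ᵥ g i) ≤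
      ∑ _g : Fin (4 * m) → κ → ZMod 2, 2 ^ m * (5 / 8 : ℝ) ^ (4 * m) := by
    rw [sum_comm]
    have h1 : ∀ a : κ → ZMod 2, a ≠ 0 →
        ∑ g : Fin (4 * m) → κ → ZMod 2, ∏ i, w (a ⬝ᵥ g i) = (5 / 8 * 2 ^ m) ^ (4 * m) := by
      intro a ha
      have := Fintype.prod_sum fun (_ : Fin (4 * m)) (x : κ → ZMod 2) => w (a ⬝ᵥ x)
      rw [← this, prod_const, hwsum a ha, card_univ, Fintype.card_fin]
    rw [sum_congr rfl fun a ha => h1 a (by simpa using ha), sum_const, sum_const, card_univ,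
      Fintype.card_fun, hcard, Fintype.card_fin, nsmul_eq_mul, nsmul_eq_mul, mul_pow]
    have h2 : (#{a : κ → ZMod 2 | a ≠ 0} : ℝ) ≤ 2 ^ m := by
      have := card_le_univ {a : κ → ZMod 2 | a ≠ 0}
      rw [hcard] at this
      exact_mod_cast this
    calc (#{a : κ → ZMod 2 | a ≠ 0} : ℝ) * ((5 / 8) ^ (4 * m) * (2 ^ m) ^ (4 * m))
        ≤ 2 ^ m * ((5 / 8) ^ (4 * m) * (2 ^ m) ^ (4 * m)) := by gcongr
      _ = _ := by push_cast; ring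
  obtain ⟨g, -, hg⟩ := exists_le_of_sum_le univ_nonempty htotal
  refine ⟨g, fun a ha => ?_⟩
  have hnn : ∀ z, 0 ≤ w z := fun z => by by_cases h : z = 0 <;> simp [w, h]
  have h1 : ∏ i, w (a ⬝ᵥ g i) ≤ 2 ^ m * (5 / 8 : ℝ) ^ (4 * m) :=
    (single_le_sum (f := fun a => ∏ i, w (a ⬝ᵥ g i)) (fun b _ => prod_nonneg fun i _ => hnn _)
      (by simpa using ha)).trans hg
  have h2 : ∏ i, w (a ⬝ᵥ g i) = (1 / 2 : ℝ) ^ (2 * #{i | a ⬝ᵥ g i ≠ 0}) := by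
    rw [prod_ite, prod_const_one, prod_const, mul_one, pow_mul]
    norm_num
  have h3 : 2 ^ m * (5 / 8 : ℝ) ^ (4 * m) ≤ (1 / 2) ^ m := by
    rw [pow_mul, ← mul_pow]
    gcongr
    norm_num
  rw [h2] at h1
  exact (pow_le_pow_iff_right_of_lt_one₀ (by norm_num) (by norm_num)).1 (h1.trans h3)

/-- Vectors orthogonal to no nonzero vector generate the cube. -/
theorem exists_sum_smul_eq {ι : Type*} [Fintype ι] {g : ι → κ → ZMod 2}
    (hg : ∀ a ≠ 0, ∃ i, a ⬝ᵥ g i ≠ 0) (x : κ → ZMod 2) : ∃ u : ι → ZMod 2, ∑ i, u i • g i = x := by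
  suffices h : Submodule.span (ZMod 2) (Set.range g) = ⊤ by
    exact (Submodule.mem_span_range_iff_exists_fun (ZMod 2)).1 (h ▸ Submodule.mem_top)
  by_contra hne
  obtain ⟨φ, hφ, hle⟩ := Submodule.exists_le_ker_of_lt_top _ (lt_top_iff_ne_top.2 hne)
  have hrep : ∀ x, φ x = (fun j => φ (Pi.single j 1)) ⬝ᵥ x := fun x => by
    rw [LinearMap.pi_apply_eq_sum_univ φ x, dotProduct]
    refine sum_congr rfl fun j _ => ?_
    rw [smul_eq_mul, mul_comm]
    congr 2
    funext k
    simp [Pi.single_apply, eq_comm]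
  have ha : (fun j => φ (Pi.single j 1)) ≠ 0 := fun h0 => hφ <| LinearMap.ext fun x => by
    rw [hrep, h0]; simp
  obtain ⟨i, hi⟩ := hg _ ha
  rw [← hrep] at hi
  exact hi (hle (Submodule.subset_span ⟨i, rfl⟩))

/-! ### The Cayley metric and the size of its balls -/

/-- The number of generators needed to represent `x`. -/
noncomputable def codeLength {ι : Type*} [Fintype ι] (g : ι → κ → ZMod 2) (x : κ → ZMod 2) : ℕ :=
  sInf {r | ∃ u : ι → ZMod 2, hammingNorm u = r ∧ ∑ i, u i • g i = x}

section codeLength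

set_option linter.unusedSectionVars false

variable {ι : Type*} [Fintype ι] [DecidableEq ι] {g : ι → κ → ZMod 2}

theorem codeLength_le (u : ι → ZMod 2) : codeLength g (∑ i, u i • g i) ≤ hammingNorm u :=
  Nat.sInf_le ⟨u, rfl, rfl⟩

theorem exists_hammingNorm_eq_codeLength (hg : ∀ a ≠ 0, ∃ i, a ⬝ᵥ g i ≠ 0) (x : κ → ZMod 2) :
    ∃ u : ι → ZMod 2, hammingNorm u = codeLength g x ∧ ∑ i, u i • g i = x := by
  obtain ⟨u, hu⟩ := exists_sum_smul_eq hg x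
  exact Nat.sInf_mem (s := {r | ∃ u : ι → ZMod 2, hammingNorm u = r ∧ ∑ i, u i • g i = x})
    ⟨_, u, rfl, hu⟩

theorem codeLength_zero : codeLength g 0 = 0 := by
  simpa using codeLength_le (g := g) 0

theorem codeLength_generator_le (i : ι) : codeLength g (g i) ≤ 1 := by
  have h := codeLength_le (g := g) (Pi.single i 1)
  have h1 : ∑ j, (Pi.single i 1 : ι → ZMod 2) j • g j = g i := by
    rw [sum_eq_single i] <;> simp +contextual
  rw [h1] at h
  refine h.trans (card_le_one.2 fun a ha b hb => ?_)
  have hi : ∀ a, (Pi.single i 1 : ι → ZMod 2) a ≠ 0 → a = i := fun a ha => by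
    by_contra hne
    simp [hne] at ha
  rw [hi a (by simpa using ha), hi b (by simpa using hb)]

theorem codeLength_add_le (hg : ∀ a ≠ 0, ∃ i, a ⬝ᵥ g i ≠ 0) (x y : κ → ZMod 2) :
    codeLength g (x + y) ≤ codeLength g x + codeLength g y := by
  obtain ⟨u, hu, rfl⟩ := exists_hammingNorm_eq_codeLength hg x
  obtain ⟨v, hv, rfl⟩ := exists_hammingNorm_eq_codeLength hg y
  rw [← hu, ← hv, ← sum_add_distrib]
  simp only [← add_smul]
  refine (codeLength_le (u + v)).trans ?_
  have h := hammingDist_triangle u 0 v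
  simpa [hammingDist_eq_hammingNorm, ← sub_eq_add_neg, cube_neg] using h

theorem eq_zero_of_codeLength_eq_zero (hg : ∀ a ≠ 0, ∃ i, a ⬝ᵥ g i ≠ 0) {x : κ → ZMod 2}
    (hx : codeLength g x = 0) : x = 0 := by
  obtain ⟨u, hu, rfl⟩ := exists_hammingNorm_eq_codeLength hg x
  rw [hx, hammingNorm_eq_zero] at hu
  simp [hu]

/-- The Cayley metric on the cube. -/
noncomputable abbrev cubeMetric (hg : ∀ a ≠ 0, ∃ i, a ⬝ᵥ g i ≠ 0) : MetricSpace (κ → ZMod 2) where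
  dist x y := codeLength g (x + y)
  dist_self x := by simp [cube_add_self, codeLength_zero]
  dist_comm x y := by rw [add_comm]
  dist_triangle x y z := by
    have h := codeLength_add_le hg (x + y) (y + z)
    rw [show x + y + (y + z) = x + (y + y) + z by abel, cube_add_self, add_zero] at h
    exact_mod_cast h
  eq_of_dist_eq_zero {x y} h := by
    have h0 := eq_zero_of_codeLength_eq_zero hg (x := x + y) (by exact_mod_cast h)
    rw [add_eq_zero_iff_eq_neg] at h0
    rw [h0, cube_neg]

/-- The weight generating function factors over coordinates. -/
theorem sum_pow_hammingNorm (s : ℝ) :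
    ∑ u : ι → ZMod 2, s ^ hammingNorm u = (1 + s) ^ Fintype.card ι := by
  have h := Fintype.prod_sum fun (_ : ι) (z : ZMod 2) => if z ≠ 0 then s else 1
  have h1 : ∑ z : ZMod 2, (if z ≠ 0 then s else 1) = 1 + s := by
    change ∑ z : Fin 2, (if z ≠ 0 then s else 1) = 1 + s
    simp [Fin.sum_univ_two]
  rw [h1, prod_const, card_univ] at h
  rw [h]
  refine sum_congr rfl fun u _ => ?_
  rw [prod_ite, prod_const_one, prod_const, mul_one, hammingNorm]

/-- Chernoff bound for the number of points in a ball of the Cayley metric. -/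
theorem card_codeLength_le_mul_pow_le (hg : ∀ a ≠ 0, ∃ i, a ⬝ᵥ g i ≠ 0) (r : ℕ) {s : ℝ}
    (hs0 : 0 ≤ s) (hs1 : s ≤ 1) :
    (#{x | codeLength g x ≤ r} : ℝ) * s ^ r ≤ (1 + s) ^ Fintype.card ι := by
  have h1 : #{x | codeLength g x ≤ r} ≤ #{u : ι → ZMod 2 | hammingNorm u ≤ r} := by
    refine (card_le_card fun x hx => ?_).trans
      (card_image_le (f := fun u : ι → ZMod 2 => ∑ i, u i • g i))
    obtain ⟨u, hu, rfl⟩ := exists_hammingNorm_eq_codeLength hg x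
    refine mem_image_of_mem _ ?_
    simpa [hu] using hx
  calc (#{x | codeLength g x ≤ r} : ℝ) * s ^ r
      ≤ (#{u : ι → ZMod 2 | hammingNorm u ≤ r} : ℝ) * s ^ r := by gcongr
    _ = ∑ u : ι → ZMod 2 with hammingNorm u ≤ r, s ^ r := by simp
    _ ≤ ∑ u : ι → ZMod 2 with hammingNorm u ≤ r, s ^ hammingNorm u :=
        sum_le_sum fun u hu => pow_le_pow_of_le_one hs0 hs1 (by simpa using hu)
    _ ≤ ∑ u : ι → ZMod 2, s ^ hammingNorm u :=
        sum_le_sum_of_subset_of_nonneg (filter_subset _ _) fun _ _ _ => by positivity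
    _ = _ := sum_pow_hammingNorm s

end codeLength

end Cube

/-! ### Packing and the metric obstruction -/

open MeasureTheory Metric in
/-- Volumetric bound for the number of `s`-separated points in a ball of radius `R`. -/
theorem card_le_of_separated_of_norm_le {V E : Type*} [NormedAddCommGroup E] [NormedSpace ℝ E]
    [FiniteDimensional ℝ E] (T : Finset V) (p : V → E) {R s : ℝ} (hs : 0 < s) (hR : 0 ≤ R)
    (hT : ∀ x ∈ T, ‖p x‖ ≤ R) (hsep : ∀ x ∈ T, ∀ y ∈ T, x ≠ y → s ≤ ‖p x - p y‖) :
    (#T : ℝ) ≤ (1 + 2 * R / s) ^ finrank ℝ E := by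
  borelize E
  let μ : Measure E := Measure.addHaar
  have hδ : 0 < s / 2 := by positivity
  have hρ : 0 < R + s / 2 := by positivity
  have hdisj : Set.PairwiseDisjoint (T : Set V) fun x => ball (p x) (s / 2) := by
    intro x hx y hy hxy
    apply ball_disjoint_ball
    rw [dist_eq_norm, add_halves]
    exact hsep x hx y hy hxy
  have hsub : (⋃ x ∈ T, ball (p x) (s / 2)) ⊆ ball (0 : E) (R + s / 2) := by
    refine Set.iUnion₂_subset fun x hx => ball_subset_ball' ?_
    rw [dist_zero_right]
    linarith [hT x hx]
  have hvol : (#T : ENNReal) * ENNReal.ofReal ((s / 2) ^ finrank ℝ E) * μ (ball 0 1) ≤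
      ENNReal.ofReal ((R + s / 2) ^ finrank ℝ E) * μ (ball 0 1) := by
    calc (#T : ENNReal) * ENNReal.ofReal ((s / 2) ^ finrank ℝ E) * μ (ball 0 1)
        = μ (⋃ x ∈ T, ball (p x) (s / 2)) := by
          rw [measure_biUnion_finset hdisj fun c _ => measurableSet_ball]
          simp only [μ.addHaar_ball_of_pos _ hδ, sum_const, nsmul_eq_mul, mul_assoc]
      _ ≤ μ (ball (0 : E) (R + s / 2)) := measure_mono hsub
      _ = _ := μ.addHaar_ball_of_pos _ hρ
  have hcancel := (ENNReal.mul_le_mul_iff_left (measure_ball_pos _ _ zero_lt_one).ne'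
    measure_ball_lt_top.ne).1 hvol
  have hreal : (#T : ℝ) * (s / 2) ^ finrank ℝ E ≤ (R + s / 2) ^ finrank ℝ E := by
    have := ENNReal.toReal_le_of_le_ofReal (by positivity) hcancel
    rwa [ENNReal.toReal_mul, ENNReal.toReal_natCast, ENNReal.toReal_ofReal (by positivity)] at this
  rw [← le_div_iff₀ (by positivity), ← div_pow] at hreal
  rwa [show (R + s / 2) / (s / 2) = 1 + 2 * R / s by field_simp; ring] at hreal

/-- For a maximal separated `T`, the `r`-balls around `T` cover `S`. No triangle inequality is used.
-/
theorem exists_separated_subset {V : Type*} [DecidableEq V] (S : Finset V) (d : V → V → ℕ)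
    (hsymm : ∀ x y, d x y = d y x) (hself : ∀ x, d x x = 0) (r M : ℕ)
    (hM : ∀ x, #{y ∈ S | d x y ≤ r} ≤ M) :
    ∃ T ⊆ S, (∀ x ∈ T, ∀ y ∈ T, x ≠ y → r < d x y) ∧ #S ≤ #T * M := by
  obtain ⟨T, hT⟩ := (S.powerset.filter fun T => ∀ x ∈ T, ∀ y ∈ T, x ≠ y → r < d x y).exists_maximal
    ⟨∅, by simp⟩
  have hTm := hT.1
  simp only [mem_filter, mem_powerset] at hTm
  refine ⟨T, hTm.1, hTm.2, ?_⟩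
  have hcover : S ⊆ T.biUnion fun x => {y ∈ S | d x y ≤ r} := by
    intro y hy
    by_contra hne
    simp only [mem_biUnion, mem_filter, not_exists, not_and, not_le] at hne
    have hfar : ∀ x ∈ T, r < d x y := fun x hx => hne x hx hy
    have hmem : insert y T ∈
        S.powerset.filter fun T => ∀ x ∈ T, ∀ y ∈ T, x ≠ y → r < d x y := by
      simp only [mem_filter, mem_powerset, insert_subset_iff]
      refine ⟨⟨hy, hTm.1⟩, fun a ha b hb hab => ?_⟩
      rcases mem_insert.1 ha with hay | ha <;> rcases mem_insert.1 hb with hby | hb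
      · exact absurd (hay.trans hby.symm) hab
      · rw [hay, hsymm]; exact hfar b hb
      · rw [hby]; exact hfar a ha
      · exact hTm.2 a ha b hb hab
    have hyT : y ∈ T := hT.2 hmem (subset_insert y T) (mem_insert_self y T)
    have := hfar y hyT
    rw [hself] at this
    exact Nat.not_lt_zero _ this
  exact (card_le_card hcover).trans (card_biUnion_le_card_mul _ _ _ fun x _ => hM x)

/-- A map with Lipschitz bound `L` on the edges of an expander sends at least half of the vertices
into a ball of radius `4 t L`. -/
theorem HasLazyGap.card_le_two_mul {V ι E : Type*} [Fintype ι] [Nonempty ι] [AddCommGroup V]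
    [Fintype V] [NormedAddCommGroup E] [NormedSpace ℝ E] [FiniteDimensional ℝ E] {g : ι → V}
    {lam : ℝ} (hg : HasLazyGap g lam) {f : V → E} {L : ℝ} (hL : 0 < L)
    (hf : ∀ x i, ‖f x - f (x + g i)‖ ≤ L) {t : ℕ} (ht1 : 0 < t)
    (ht : 4 * (finrank ℝ E : ℝ) ^ 2 * lam ^ (2 * t) ≤ 1) :
    ∃ c : E, Fintype.card V ≤ 2 * #{x | ‖f x - c‖ ≤ 4 * (t * L)} := by
  have hV : (0 : ℝ) < Fintype.card V := by exact_mod_cast Fintype.card_pos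
  set c : E := (Fintype.card V : ℝ)⁻¹ • ∑ x, f x
  have h0 : ∑ x, (f x - c) = 0 := by
    rw [sum_sub_distrib, sum_const, card_univ, ← Nat.cast_smul_eq_nsmul ℝ, smul_smul,
      mul_inv_cancel₀ hV.ne', one_smul, sub_self]
  have hP := hg.sum_norm_sq_le (f := fun x => f x - c) hL.le
    (fun x i => by simpa using hf x i) h0 ht
  refine ⟨c, ?_⟩
  have htL : 0 < (t : ℝ) * L := by positivity
  -- Markov's inequality at radius `4tL`: at most a quarter of the vertices lie outside.
  have hmarkov : (#{x | ¬ ‖f x - c‖ ≤ 4 * (t * L)} : ℝ) * (4 * (t * L)) ^ 2 ≤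
      4 * Fintype.card V * (t * L) ^ 2 := by
    refine le_trans ?_ hP
    calc (#{x | ¬ ‖f x - c‖ ≤ 4 * (t * L)} : ℝ) * (4 * (t * L)) ^ 2
        = ∑ x with ¬ ‖f x - c‖ ≤ 4 * (t * L), (4 * (t * L)) ^ 2 := by simp
      _ ≤ ∑ x with ¬ ‖f x - c‖ ≤ 4 * (t * L), ‖f x - c‖ ^ 2 :=
          sum_le_sum fun x hx => by
            have := (mem_filter.1 hx).2
            push Not at this
            gcongr
      _ ≤ _ := sum_le_sum_of_subset_of_nonneg (filter_subset _ _) fun _ _ _ => by positivity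
  have hbad : 4 * (#{x | ¬ ‖f x - c‖ ≤ 4 * (t * L)} : ℝ) ≤ Fintype.card V := by
    refine le_of_mul_le_mul_right ?_ (by positivity : 0 < 4 * (t * L) ^ 2)
    linarith
  have hbad' : 4 * #{x | ¬ ‖f x - c‖ ≤ 4 * (t * L)} ≤ Fintype.card V := by exact_mod_cast hbad
  have := card_filter_add_card_filter_not (s := (univ : Finset V))
    fun x => ‖f x - c‖ ≤ 4 * (t * L)
  rw [card_univ] at this
  omega

/-- The metric obstruction: there is a metric on a set of `2 ^ (40 q)` points whose embeddings with
distortion `α` into normed spaces satisfy both a volumetric and a diameter bound. -/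
theorem exists_metric_obstruction (q : ℕ) (hq : 1 ≤ q) :
    ∃ _ : MetricSpace (Fin (40 * q) → ZMod 2), ∀ (E : Type) [NormedAddCommGroup E]
      [NormedSpace ℝ E] [FiniteDimensional ℝ E] (f : (Fin (40 * q) → ZMod 2) → E) (τ α : ℝ) (t : ℕ),
      0 < τ → 0 < α → 0 < t → 4 * (finrank ℝ E : ℝ) ^ 2 * (7 / 8 : ℝ) ^ (2 * t) ≤ 1 →
      (∀ x y, τ * dist x y ≤ dist (f x) (f y) ∧ dist (f x) (f y) ≤ α * τ * dist x y) →
      (2 : ℝ) ^ (25 * q) ≤ 2 * (1 + 8 * t * α / q) ^ finrank ℝ E ∧ (q : ℝ) ≤ 8 * t * α := by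
  obtain ⟨g, hg⟩ := exists_generators (κ := Fin (40 * q)) (40 * q) (by simp)
  have hgen : ∀ a ≠ 0, ∃ i, a ⬝ᵥ g i ≠ 0 := by
    intro a ha
    have h1 := hg a ha
    by_contra! h
    simp [h] at h1
    omega
  refine ⟨cubeMetric hgen, ?_⟩
  intro E _ _ _ f τ α t hτ hα ht1 ht hf
  have hf' : ∀ x y, τ * codeLength g (x + y) ≤ ‖f x - f y‖ ∧
      ‖f x - f y‖ ≤ α * τ * codeLength g (x + y) := fun x y => by
    rw [← dist_eq_norm]; exact hf x y
  have : Nonempty (Fin (4 * (40 * q))) := ⟨⟨0, by omega⟩⟩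
  have hgap : HasLazyGap g (7 / 8) := by
    have := hasLazyGap_of_weight g (δ := 1 / 8) fun a ha => by
      have h1 : ((40 * q : ℕ) : ℝ) ≤ ((2 * #{i | a ⬝ᵥ g i ≠ 0} : ℕ) : ℝ) := by
        exact_mod_cast hg a ha
      rw [Fintype.card_fin]
      push_cast at h1 ⊢
      linarith
    convert this using 1
    norm_num
  have hL : 0 < α * τ := by positivity
  have hedge : ∀ x i, ‖f x - f (x + g i)‖ ≤ α * τ := by
    intro x i
    refine (hf' x _).2.trans ?_
    rw [← add_assoc, cube_add_self, zero_add]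
    have : (codeLength g (g i) : ℝ) ≤ 1 := by exact_mod_cast codeLength_generator_le i
    exact mul_le_of_le_one_right hL.le this
  obtain ⟨c, hc⟩ := hgap.card_le_two_mul hL hedge ht1 ht
  -- With `s = 1/32`, the `160q` generators contribute `2^(10q)` because `(33/32)^16 ≤ 2`, and
  -- `s^(-q) = 2^(5q)`.
  have hball0 : #{x | codeLength g x ≤ q} ≤ 2 ^ (15 * q) := by
    have h1 := card_codeLength_le_mul_pow_le hgen q (s := 1 / 32) (by norm_num) (by norm_num)
    rw [Fintype.card_fin] at h1
    have h2 : (1 + 1 / 32 : ℝ) ^ (4 * (40 * q)) ≤ 2 ^ (10 * q) := by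
      rw [show 4 * (40 * q) = 16 * (10 * q) by ring, pow_mul]
      gcongr
      norm_num
    have h3 : (#{x | codeLength g x ≤ q} : ℝ) ≤ 2 ^ (15 * q) := by
      have h4 := h1.trans h2
      rw [one_div, inv_pow, ← div_eq_mul_inv, div_le_iff₀ (by positivity)] at h4
      refine h4.trans_eq ?_
      rw [show (32 : ℝ) = 2 ^ 5 by norm_num, ← pow_mul, ← pow_add]
      congr 1
      ring
    exact_mod_cast h3
  set S : Finset (Fin (40 * q) → ZMod 2) := {x | ‖f x - c‖ ≤ 4 * (t * (α * τ))}
  obtain ⟨T, hTS, hsep, hTcard⟩ := exists_separated_subset S (fun x y => codeLength g (x + y))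
    (fun x y => by rw [add_comm]) (fun x => by simp [cube_add_self, codeLength_zero]) q
    (2 ^ (15 * q)) fun x => by
      refine le_trans ?_ hball0
      refine card_le_card_of_injOn (fun y => x + y) (fun y hy => ?_) fun y _ z _ h => by simpa using h
      simpa using (mem_filter.1 hy).2
  have hT2 : (2 : ℝ) ^ (25 * q) ≤ 2 * #T := by
    have h1 : 2 ^ (40 * q) ≤ 2 * (#T * 2 ^ (15 * q)) := by
      have : Fintype.card (Fin (40 * q) → ZMod 2) = 2 ^ (40 * q) := by simp [ZMod.card]
      rw [← this]
      exact hc.trans (Nat.mul_le_mul_left 2 hTcard)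
    have h2 : 2 ^ (25 * q) ≤ 2 * #T := by
      refine Nat.le_of_mul_le_mul_right ?_ (by positivity : 0 < 2 ^ (15 * q))
      rw [← pow_add, mul_assoc]
      convert h1 using 2
      ring
    exact_mod_cast h2
  have hq0 : (0 : ℝ) < q := by exact_mod_cast hq
  have hfar : ∀ x ∈ T, ∀ y ∈ T, x ≠ y → τ * q ≤ ‖f x - f y‖ := fun x hx y hy hxy => by
    refine le_trans ?_ (hf' x y).1
    have : (q : ℝ) ≤ codeLength g (x + y) := by exact_mod_cast (hsep x hx y hy hxy).le
    gcongr
  have hnear : ∀ x ∈ T, ‖f x - c‖ ≤ 4 * (t * (α * τ)) := fun x hx => (mem_filter.1 (hTS hx)).2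
  constructor
  · refine hT2.trans ?_
    have := card_le_of_separated_of_norm_le T (fun x => f x - c) (by positivity : 0 < τ * q)
      (by positivity : 0 ≤ 4 * (t * (α * τ))) hnear
      fun x hx y hy hxy => by simpa using hfar x hx y hy hxy
    rw [show 2 * (4 * (t * (α * τ))) / (τ * q) = 8 * t * α / q by field_simp; ring] at this
    linarith
  · have h1 : 1 < #T := by
      have h3 : (2 : ℝ) ^ 2 ≤ 2 ^ (25 * q) := pow_le_pow_right₀ (by norm_num) (by omega)
      have : (1 : ℝ) < #T := by linarith
      exact_mod_cast this
    obtain ⟨x, hx, y, hy, hxy⟩ := one_lt_card.1 h1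
    have h4 := hfar x hx y hy hxy
    have h5 : ‖f x - f y‖ ≤ ‖f x - c‖ + ‖f y - c‖ := by
      rw [← dist_eq_norm, ← dist_eq_norm, ← dist_eq_norm]
      exact dist_triangle_right _ _ _
    have h6 := hnear x hx
    have h7 := hnear y hy
    refine le_of_mul_le_mul_left ?_ hτ
    linarith

/-! ### Transfer to `EllInfty` and attainment of the modulus -/

/-- A dimension reduction bound for `ℓ_∞` applies to every metric space with at most `n` points. -/
theorem HasDimReduction.exists_embedding {n k : ℕ} {α : ℝ} (h : HasDimReduction EllInfty n α k)
    (V : Type) [Fintype V] [MetricSpace V] (hV : Fintype.card V ≤ n) :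
    ∃ F : Submodule ℝ EllInfty, FiniteDimensional ℝ F ∧ finrank ℝ F = k ∧
      EmbedsWithDistortion V F α := by
  classical
  have hiso := kuratowskiEmbedding.isometry V
  have : Infinite EllInfty := by
    have : Nontrivial EllInfty :=
      ⟨⟨lp.single ⊤ 0 1, 0, fun h => by simpa using congrArg (fun v : EllInfty => v 0) h⟩⟩
    exact Module.Free.infinite ℝ EllInfty
  -- `HasDimReduction` speaks of exactly `n` points, so the image is padded.
  obtain ⟨C, hsub, hC⟩ := Infinite.exists_superset_card_eq
    ((univ : Finset V).image (kuratowskiEmbedding V)) n (card_image_le.trans (by simpa using hV))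
  obtain ⟨F, hF, hk, ψ, τ, hτ, hψ⟩ := h C hC
  refine ⟨F, hF, hk, fun x => ψ ⟨kuratowskiEmbedding V x, hsub (mem_image_of_mem _ (mem_univ x))⟩,
    τ, hτ, fun x y => ?_⟩
  have := hψ ⟨kuratowskiEmbedding V x, hsub (mem_image_of_mem _ (mem_univ x))⟩
    ⟨kuratowskiEmbedding V y, hsub (mem_image_of_mem _ (mem_univ y))⟩
  rwa [Subtype.dist_eq ⟨kuratowskiEmbedding V x, _⟩, hiso.dist_eq] at this

/-- Two points cannot be separated in dimension `0`. This keeps `1/(2k)` away from the convention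
for division by zero. -/
theorem HasDimReduction.pos {n k : ℕ} {α : ℝ} (hn : 2 ≤ n)
    (h : HasDimReduction EllInfty n α k) : 0 < k := by
  by_contra hk0
  obtain ⟨F, hF, hk, f, τ, hτ, hf⟩ := h.exists_embedding ({0, 1} : Finset ℝ) (by simpa using hn)
  have : Subsingleton F := (finrank_zero_iff (R := ℝ)).1 (by omega)
  have h1 := (hf ⟨0, by simp⟩ ⟨1, by simp⟩).1
  rw [Subsingleton.elim (f _) (f ⟨1, by simp⟩), dist_self, Subtype.dist_eq] at h1
  norm_num at h1
  linarith

theorem not_finiteDimensional_ellInfty : ¬ FiniteDimensional ℝ EllInfty := by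
  intro hfin
  let φ : EllInfty →ₗ[ℝ] (ℕ → ℝ) :=
    { toFun := fun v => v, map_add' := fun _ _ => rfl, map_smul' := fun _ _ => rfl }
  have hli : LinearIndependent ℝ fun i : ℕ => (lp.single ⊤ i (1 : ℝ) : EllInfty) := by
    refine LinearIndependent.of_comp φ ?_
    convert Pi.linearIndependent_single_one ℕ ℝ using 1
    funext i j
    change (lp.single ⊤ i (1 : ℝ) : EllInfty) j = _
    rw [lp.coeFn_single]
  have := hli.finite
  exact not_finite ℕ

theorem exists_submodule_finrank_eq {E : Type*} [AddCommGroup E] [Module ℝ E]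
    (hE : ¬ FiniteDimensional ℝ E) (W : Submodule ℝ E) [FiniteDimensional ℝ W] (n : ℕ)
    (hn : finrank ℝ W ≤ n) :
    ∃ F : Submodule ℝ E, W ≤ F ∧ FiniteDimensional ℝ F ∧ finrank ℝ F = n := by
  induction n, hn using Nat.le_induction with
  | base => exact ⟨W, le_rfl, inferInstance, rfl⟩
  | succ n _ ih =>
    obtain ⟨F, hWF, hF, hFn⟩ := ih
    have hne : F ≠ ⊤ := by
      rintro rfl
      exact hE (finite_def.2 (Submodule.fg_top _ |>.1 (finite_def.1 hF) |> fun h => by simpa using h))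
    obtain ⟨x, -, hx⟩ := SetLike.exists_of_lt (lt_top_iff_ne_top.2 hne)
    refine ⟨F ⊔ Submodule.span ℝ {x}, hWF.trans le_sup_left, inferInstance, ?_⟩
    have hx0 : x ≠ 0 := fun h => hx (h ▸ F.zero_mem)
    have h1 := Submodule.finrank_sup_add_finrank_inf_eq F (Submodule.span ℝ {x})
    have h2 : F ⊓ Submodule.span ℝ {x} = ⊥ :=
      disjoint_iff.1 ((Submodule.disjoint_span_singleton' hx0).2 hx)
    rw [h2, finrank_bot, finrank_span_singleton hx0, hFn] at h1
    omega

/-- The span of the set, enlarged to dimension exactly `n`, works isometrically. Hence the infimum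
defining the modulus is attained rather than being the default `0` of an empty set. -/
theorem hasDimReduction_self {n : ℕ} {α : ℝ} (hα : 1 ≤ α) : HasDimReduction EllInfty n α n := by
  intro C hC
  obtain ⟨F, hle, hF, hn⟩ := exists_submodule_finrank_eq not_finiteDimensional_ellInfty
    (Submodule.span ℝ (C : Set EllInfty)) n (hC ▸ finrank_span_finset_le_card C)
  refine ⟨F, hF, hn, fun x => ⟨x, hle (Submodule.subset_span x.2)⟩, 1, one_pos, fun x y => ?_⟩
  rw [mul_one, one_mul, Subtype.dist_eq x y, Subtype.dist_eq]
  exact ⟨le_rfl, le_mul_of_one_le_left dist_nonneg hα⟩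

theorem hasDimReduction_dimReductionModulus {n : ℕ} {α : ℝ} (hα : 1 ≤ α) :
    HasDimReduction EllInfty n α (dimReductionModulus EllInfty n α) :=
  Nat.sInf_mem (s := {k | HasDimReduction EllInfty n α k}) ⟨n, hasDimReduction_self hα⟩

/-! ### The first inequality -/

/-- The number of steps that the Poincaré inequality needs in dimension `k` is logarithmic. -/
theorem exists_steps {k : ℕ} (hk : 0 < k) :
    ∃ t : ℕ, 0 < t ∧ 4 * (k : ℝ) ^ 2 * (7 / 8 : ℝ) ^ (2 * t) ≤ 1 ∧
      (t : ℝ) ≤ 27 * Real.log (k + 1) := by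
  have hk1 : (1 : ℝ) ≤ k := by exact_mod_cast hk
  set s := Nat.log 2 k + 2
  -- `2k ≤ 2^s` and `(7/8)^12 ≤ 1/4`.
  refine ⟨6 * s, by omega, ?_, ?_⟩
  · have h1 : k < 2 ^ (Nat.log 2 k + 1) := Nat.lt_pow_succ_log_self (by norm_num) k
    have h2 : (2 * k : ℝ) ≤ 2 ^ s := by
      have : 2 * k ≤ 2 ^ s := by
        rw [show s = Nat.log 2 k + 1 + 1 from rfl, pow_succ]
        omega
      exact_mod_cast this
    have h3 : (7 / 8 : ℝ) ^ (2 * (6 * s)) ≤ (1 / 4) ^ s := by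
      rw [show 2 * (6 * s) = 12 * s by ring, pow_mul]
      gcongr
      norm_num
    calc 4 * (k : ℝ) ^ 2 * (7 / 8 : ℝ) ^ (2 * (6 * s)) = (2 * k) ^ 2 * (7 / 8) ^ (2 * (6 * s)) := by
          ring
      _ ≤ (2 ^ s) ^ 2 * (1 / 4) ^ s := by gcongr
      _ = 1 := by
          rw [← pow_mul, mul_comm s 2, pow_mul, ← mul_pow]
          norm_num
  · have h1 : (2 : ℝ) ^ Nat.log 2 k ≤ k := by exact_mod_cast Nat.pow_log_le_self 2 hk.ne'
    have h2 : Nat.log 2 k * Real.log 2 ≤ Real.log k := by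
      rw [← Real.log_pow]
      exact Real.log_le_log (by positivity) h1
    have h3 : Real.log k ≤ Real.log (k + 1) := Real.log_le_log (by positivity) (by linarith)
    have h4 : Real.log 2 ≤ Real.log (k + 1) := Real.log_le_log (by norm_num) (by linarith)
    have h5 := Real.log_two_gt_d9
    have h6 : s * Real.log 2 ≤ 3 * Real.log (k + 1) := by
      simp only [s]
      push_cast
      linarith
    have h7 : (s : ℝ) * 0.69 ≤ s * Real.log 2 := by gcongr; linarith
    push_cast
    linarith

/-- Source of the exponent `1/(2k)`: `40(q+1) ≤ 2(25q-1)` as soon as `q ≥ 5`. -/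
theorem rpow_one_div_le {n k q : ℕ} {Q : ℝ} (hk : 0 < k) (hq : 5 ≤ q) (hQ : 0 ≤ Q)
    (hn : n ≤ 2 ^ (40 * (q + 1))) (h : (2 : ℝ) ^ (25 * q) ≤ 2 * Q ^ k) :
    (n : ℝ) ^ (1 / (2 * (k : ℝ))) ≤ Q := by
  have hk0 : (0 : ℝ) < k := by exact_mod_cast hk
  have hpow : (2 : ℝ) ^ (25 * q - 1) ≤ Q ^ k := by
    have : (2 : ℝ) ^ (25 * q) = 2 * 2 ^ (25 * q - 1) := by
      rw [← pow_succ', Nat.sub_add_cancel (by omega)]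
    linarith
  have h1 : (n : ℝ) ≤ Q ^ (2 * (k : ℝ)) := by
    calc (n : ℝ) ≤ 2 ^ (40 * (q + 1)) := by exact_mod_cast hn
      _ ≤ (2 : ℝ) ^ ((25 * q - 1) * 2) := pow_le_pow_right₀ (by norm_num) (by omega)
      _ = (2 ^ (25 * q - 1)) ^ 2 := pow_mul _ _ _
      _ ≤ (Q ^ k) ^ 2 := by gcongr
      _ = Q ^ ((2 * k : ℕ) : ℝ) := by rw [← pow_mul, mul_comm k 2, Real.rpow_natCast]
      _ = Q ^ (2 * (k : ℝ)) := by push_cast; rfl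
  calc (n : ℝ) ^ (1 / (2 * (k : ℝ))) ≤ (Q ^ (2 * (k : ℝ))) ^ (1 / (2 * (k : ℝ))) :=
        Real.rpow_le_rpow (Nat.cast_nonneg n) h1 (by positivity)
    _ = Q := by rw [one_div, Real.rpow_rpow_inv hQ (by positivity)]

theorem rpow_mul_log_le_of_hasDimReduction {n k : ℕ} {α : ℝ} (hα : 1 ≤ α) (hn : 2 ^ 200 ≤ n)
    (hk : 0 < k) (h : HasDimReduction EllInfty n α k) :
    (n : ℝ) ^ (1 / (2 * (k : ℝ))) * Real.log n ≤ 20000 * (α * Real.log (k + 1)) := by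
  set q := Nat.log 2 n / 40
  have hn0 : n ≠ 0 := by rintro rfl; simp at hn
  have hlog : 200 ≤ Nat.log 2 n := (Nat.le_log_iff_pow_le (by norm_num) hn0).2 hn
  have hq : 5 ≤ q := by omega
  have hlow : 2 ^ (40 * q) ≤ n :=
    (Nat.pow_le_pow_right (by norm_num) (by omega)).trans (Nat.pow_log_le_self 2 hn0)
  have hupp : n ≤ 2 ^ (40 * (q + 1)) :=
    (Nat.lt_pow_succ_log_self (by norm_num) n).le.trans
      (Nat.pow_le_pow_right (by norm_num) (by omega))
  clear_value q
  obtain ⟨t, ht1, ht2, ht3⟩ := exists_steps hk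
  obtain ⟨inst, hV⟩ := exists_metric_obstruction q (by omega)
  obtain ⟨F, hF, hFk, f, τ, hτ, hf⟩ := h.exists_embedding (Fin (40 * q) → ZMod 2)
    (by simpa [ZMod.card] using hlow)
  obtain ⟨hvol, hdiam⟩ := hV F f τ α t hτ (by linarith) ht1 (by rwa [hFk]) hf
  rw [hFk] at hvol
  have hq0 : (0 : ℝ) < q := by exact_mod_cast (by omega : 0 < q)
  have hk0 : (0 : ℝ) < k := by exact_mod_cast hk
  have hα0 : 0 < α := by linarith
  have hlogn0 : 0 ≤ Real.log n := Real.log_natCast_nonneg n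
  have hlogn : Real.log n ≤ 34 * q := by
    have h1 : Real.log n ≤ (40 * (q + 1) : ℕ) * Real.log 2 := by
      rw [← Real.log_pow]
      exact Real.log_le_log (by exact_mod_cast Nat.pos_of_ne_zero hn0) (by exact_mod_cast hupp)
    have h2 : ((40 * (q + 1) : ℕ) : ℝ) ≤ 48 * q := by
      have : 40 * (q + 1) ≤ 48 * q := by omega
      exact_mod_cast this
    have h3 := Real.log_two_lt_d9
    have h4 := Real.log_two_gt_d9
    calc Real.log n ≤ (40 * (q + 1) : ℕ) * Real.log 2 := h1
      _ ≤ 48 * q * 0.7 := by gcongr; linarith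
      _ ≤ 34 * q := by linarith
  set Q := 1 + 8 * t * α / q
  -- The diameter bound is needed here, to absorb the summand `1` of `Q`.
  have hQ1 : 8 * t * α / q ≥ 1 := by
    rw [ge_iff_le, le_div_iff₀ hq0, one_mul]
    exact hdiam
  have hQ : Q ≤ 16 * t * α / q := by
    have : 16 * t * α / q = 8 * t * α / q + 8 * t * α / q := by ring
    rw [this]
    simp only [Q]
    linarith
  have hQ0 : 0 ≤ Q := by simp only [Q]; linarith
  have hroot : (n : ℝ) ^ (1 / (2 * (k : ℝ))) ≤ Q := rpow_one_div_le hk hq hQ0 hupp hvol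
  clear hn hlow hupp hvol hV
  calc (n : ℝ) ^ (1 / (2 * (k : ℝ))) * Real.log n ≤ 16 * t * α / q * (34 * q) :=
        mul_le_mul (hroot.trans hQ) hlogn hlogn0 (by positivity)
    _ = 544 * t * α := by field_simp; ring
    _ ≤ 544 * (27 * Real.log (k + 1)) * α := by gcongr
    _ ≤ 20000 * (α * Real.log (k + 1)) := by
        have : 0 ≤ α * Real.log (k + 1) := mul_nonneg hα0.le (Real.log_nonneg (by linarith))
        linarith

/-- The main lower bound on the dimension reduction modulus of `ℓ_∞`. -/
theorem exists_const_rpow_mul_log_le :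
    ∃ c : ℝ, 0 < c ∧ ∀ n : ℕ, 2 ≤ n → ∀ α : ℝ, 1 ≤ α →
      c * ((n : ℝ) ^ (1 / (2 * (dimReductionModulus EllInfty n α : ℝ))) * Real.log n)
        ≤ α * Real.log ((dimReductionModulus EllInfty n α : ℝ) + 1) := by
  -- Chosen for `n < 2^200`, where the root and the logarithm are each at most `2^200` and the right
  -- side is at least `1/2`.
  refine ⟨1 / (2 * ((2 : ℝ) ^ 200) ^ 2), by positivity, fun n hn α hα => ?_⟩
  have h := hasDimReduction_dimReductionModulus (n := n) hα
  have hk := h.pos hn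
  set k := dimReductionModulus EllInfty n α
  have hk1 : (1 : ℝ) ≤ k := by exact_mod_cast hk
  have hlogk : 1 / 2 ≤ Real.log (k + 1) := by
    have h1 : Real.log 2 ≤ Real.log (k + 1) := Real.log_le_log (by norm_num) (by linarith)
    linarith [Real.log_two_gt_d9]
  have hR : 1 / 2 ≤ α * Real.log (k + 1) := by nlinarith
  rw [one_div_mul_eq_div, div_le_iff₀ (by positivity)]
  rcases le_or_gt (2 ^ 200) n with hbig | hsmall
  · refine (rpow_mul_log_le_of_hasDimReduction hα hbig hk h).trans ?_
    rw [mul_comm]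
    gcongr
    norm_num
  · have hn1 : (1 : ℝ) ≤ n := by exact_mod_cast (by omega : 1 ≤ n)
    have hn2 : (n : ℝ) ≤ 2 ^ 200 := by exact_mod_cast hsmall.le
    have h1 : (n : ℝ) ^ (1 / (2 * (k : ℝ))) ≤ n := by
      conv_rhs => rw [← Real.rpow_one (n : ℝ)]
      refine Real.rpow_le_rpow_of_exponent_le hn1 ?_
      rw [div_le_one (by positivity)]
      linarith
    have h2 : Real.log n ≤ n := (Real.log_le_sub_one_of_pos (by linarith)).trans (by linarith)
    calc (n : ℝ) ^ (1 / (2 * (k : ℝ))) * Real.log n ≤ 2 ^ 200 * 2 ^ 200 :=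
          mul_le_mul (h1.trans hn2) (h2.trans hn2) (Real.log_nonneg hn1) (by positivity)
      _ = 1 / 2 * (2 * (2 ^ 200) ^ 2) := by ring
      _ ≤ _ := by gcongr

/-! ### Consequences for the modulus -/

/-- The first inequality implies the power-type lower bound on the dimension. -/
theorem half_rpow_le_of_log_le {c α k n : ℝ} (hn : 0 < n) (hα : 0 < α) (hk : 1 ≤ k)
    (h : c * Real.log n ≤ α * Real.log (k + 1)) : 1 / 2 * n ^ (c / α) ≤ k := by
  have h1 : n ^ (c / α) ≤ k + 1 := by
    rw [Real.rpow_def_of_pos hn, ← Real.le_log_iff_exp_le (by linarith), mul_div_assoc',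
      div_le_iff₀ hα]
    linarith
  linarith

/-- `11/4` exceeds `e`, so `log log log n` stays above a positive constant for `n ≥ 20`. -/
theorem log_ge_of_twenty_le {n : ℕ} (hn : 20 ≤ n) : 11 / 4 ≤ Real.log n := by
  have h1 : Real.exp (11 / 4) ≤ 20 := by
    have h2 : Real.exp (11 / 4) ^ 4 ≤ 20 ^ 4 := by
      rw [← Real.exp_nat_mul, show ((4 : ℕ) : ℝ) * (11 / 4) = (11 : ℕ) * 1 by norm_num,
        Real.exp_nat_mul]
      calc Real.exp 1 ^ 11 ≤ 2.72 ^ 11 := by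
            gcongr
            linarith [Real.exp_one_lt_d9]
        _ ≤ 20 ^ 4 := by norm_num
    exact (pow_le_pow_iff_left₀ (Real.exp_pos _).le (by norm_num) (by norm_num)).1 h2
  have hn' : (20 : ℝ) ≤ n := by exact_mod_cast hn
  rw [Real.le_log_iff_exp_le (by linarith)]
  exact h1.trans hn'

theorem log_log_ge_of_twenty_le {n : ℕ} (hn : 20 ≤ n) :
    Real.log (11 / 4) ≤ Real.log (Real.log n) :=
  Real.log_le_log (by norm_num) (log_ge_of_twenty_le hn)

theorem one_lt_log_eleven_div_four : 1 < Real.log (11 / 4) := by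
  rw [Real.lt_log_iff_exp_lt (by norm_num)]
  linarith [Real.exp_one_lt_d9]

/-- If `k` satisfies the first inequality at `n = exp ℓ`, then it satisfies the second one. -/
theorem exists_const_div_log_le {c : ℝ} (hc : 0 < c) :
    ∃ κ : ℝ, 0 < κ ∧ ∀ ℓ α k : ℝ, 11 / 4 ≤ ℓ → 0 < α → 1 ≤ k →
      c * (Real.exp (ℓ / (2 * k)) * ℓ) ≤ α * Real.log (k + 1) →
      κ * (ℓ / Real.log (ℓ / α + α * Real.log ℓ / ℓ)) ≤ k := by
  -- If the bound failed with `κ = 1/(2(p+1))`, then `exp(ℓ/(2k)) ≥ W^(p+1)` and `k ≤ ℓ`, so `c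
  -- W^(p+1) u ≤ 2Λ`. But `uW ≥ Λ` and `W ≥ 2` give `W^(p+1) u ≥ 2^p Λ`, and `c 2^p > 2`.
  obtain ⟨p, hp⟩ := pow_unbounded_of_one_lt (2 / c) one_lt_two
  have hp2 : (0 : ℝ) < 2 * (p + 1) := by positivity
  refine ⟨1 / (2 * (p + 1)), by positivity, fun ℓ α k hℓ hα hk h => ?_⟩
  by_contra! hlt
  have hℓ0 : 0 < ℓ := by linarith
  set u := ℓ / α
  set Λ := Real.log ℓ
  have hu : 0 < u := by positivity
  have hΛ : 1 < Λ :=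
    one_lt_log_eleven_div_four.trans_le (Real.log_le_log (by norm_num) hℓ)
  have hW : ℓ / α + α * Λ / ℓ = u + Λ / u := by
    simp only [u]
    field_simp
  rw [hW] at hlt
  set W := u + Λ / u
  have huW : Λ ≤ u * W := by
    have : u * W = u ^ 2 + Λ := by simp only [W]; field_simp
    nlinarith
  have hW2 : 2 ≤ W := by
    have h1 : u * 2 ≤ u * W := by
      have : u * W = u ^ 2 + Λ := by simp only [W]; field_simp
      nlinarith [sq_nonneg (u - 1)]
    exact le_of_mul_le_mul_left h1 hu
  have hlogW : 0 < Real.log W := Real.log_pos (by linarith)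
  have hlogW2 : 1 / 2 ≤ Real.log W := by
    have := Real.log_le_log (by norm_num) hW2
    linarith [Real.log_two_gt_d9]
  have hkℓ : k ≤ ℓ := by
    have h1 : ℓ / Real.log W ≤ 2 * ℓ := by
      rw [div_le_iff₀ hlogW]
      nlinarith
    have h2 : 1 / (2 * ((p : ℝ) + 1)) ≤ 1 / 2 := by
      apply one_div_le_one_div_of_le <;> linarith [(Nat.cast_nonneg p : (0 : ℝ) ≤ p)]
    calc k ≤ 1 / (2 * (p + 1)) * (ℓ / Real.log W) := hlt.le
      _ ≤ 1 / 2 * (2 * ℓ) := by gcongr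
      _ = ℓ := by ring
  have hlogk : Real.log (k + 1) ≤ 2 * Λ := by
    rw [← Real.log_rpow hℓ0]
    apply Real.log_le_log (by linarith)
    norm_num
    nlinarith
  have hexp : W ^ (p + 1) ≤ Real.exp (ℓ / (2 * k)) := by
    rw [← Real.log_le_iff_le_exp (by positivity), Real.log_pow]
    rw [one_div_mul_eq_div, lt_div_iff₀ hp2, lt_div_iff₀ hlogW] at hlt
    rw [le_div_iff₀ (by positivity)]
    push_cast
    linarith
  have hmain : c * (W ^ (p + 1) * u) ≤ 2 * Λ := by
    have h1 : c * (Real.exp (ℓ / (2 * k)) * u) ≤ Real.log (k + 1) := by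
      refine le_of_mul_le_mul_left ?_ hα
      have : α * u = ℓ := by simp only [u]; field_simp
      calc α * (c * (Real.exp (ℓ / (2 * k)) * u)) = c * (Real.exp (ℓ / (2 * k)) * (α * u)) := by
            ring
        _ ≤ _ := by rw [this]; exact h
    refine le_trans ?_ (h1.trans hlogk)
    gcongr
  have hlow : 2 ^ p * Λ ≤ W ^ (p + 1) * u := by
    calc 2 ^ p * Λ ≤ W ^ p * (u * W) := by gcongr
      _ = W ^ (p + 1) * u := by ring
  have hp' : 2 < 2 ^ p * c := (div_lt_iff₀ hc).1 hp
  have h1 : c * (2 ^ p * Λ) ≤ 2 * Λ := (mul_le_mul_of_nonneg_left hlow hc.le).trans hmain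
  nlinarith

/-- For `α` of order `ℓ`, the iterated logarithm controls the denominator. -/
theorem exists_const_log_le {a b : ℝ} (ha : 0 < a) (hab : a ≤ b) :
    ∃ K : ℝ, 0 < K ∧ ∀ ℓ α : ℝ, 11 / 4 ≤ ℓ → a * ℓ ≤ α → α ≤ b * ℓ →
      0 < Real.log (ℓ / α + α * Real.log ℓ / ℓ) ∧
      Real.log (ℓ / α + α * Real.log ℓ / ℓ) ≤ K * Real.log (Real.log ℓ) := by
  have hℓ0 : 0 < Real.log (Real.log (11 / 4)) := Real.log_pos one_lt_log_eleven_div_four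
  set B := |Real.log (1 / a + b)|
  refine ⟨B / Real.log (Real.log (11 / 4)) + 1, by positivity, fun ℓ α hℓ h1 h2 => ?_⟩
  have hℓp : 0 < ℓ := by linarith
  have hαp : 0 < α := lt_of_lt_of_le (by positivity) h1
  have hΛ0 : Real.log (11 / 4) ≤ Real.log ℓ := Real.log_le_log (by norm_num) hℓ
  set Λ := Real.log ℓ
  have hΛ : 1 < Λ := one_lt_log_eleven_div_four.trans_le hΛ0
  have hll : Real.log (Real.log (11 / 4)) ≤ Real.log Λ :=
    Real.log_le_log (by linarith [one_lt_log_eleven_div_four]) hΛ0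
  have hu1 : ℓ / α ≤ 1 / a := by
    rw [div_le_div_iff₀ hαp ha]
    linarith
  have hu2 : α * Λ / ℓ ≤ b * Λ := by
    rw [div_le_iff₀ hℓp]
    nlinarith
  have hb : 0 < b := ha.trans_le hab
  -- As `Λ > 1`, this is `u + 1/u ≥ 2` with `u = ℓ/α`.
  have hge : 2 ≤ ℓ / α + α * Λ / ℓ := by
    rw [div_add_div _ _ hαp.ne' hℓp.ne', le_div_iff₀ (by positivity)]
    nlinarith [sq_nonneg (ℓ - α), mul_pos hαp hαp]
  refine ⟨Real.log_pos (by linarith), ?_⟩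
  calc Real.log (ℓ / α + α * Λ / ℓ) ≤ Real.log ((1 / a + b) * Λ) := by
        apply Real.log_le_log (by linarith)
        have : 1 / a ≤ 1 / a * Λ := le_mul_of_one_le_right (by positivity) hΛ.le
        linarith
    _ = Real.log (1 / a + b) + Real.log Λ := Real.log_mul (by positivity) (by linarith)
    _ ≤ B / Real.log (Real.log (11 / 4)) * Real.log Λ + Real.log Λ := by
        gcongr
        calc Real.log (1 / a + b) ≤ B := le_abs_self _
          _ = B / Real.log (Real.log (11 / 4)) * Real.log (Real.log (11 / 4)) := by field_simp
          _ ≤ _ := by gcongr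
    _ = _ := by ring

theorem mainTheorem6 :
    -- the inequality `α log (k + 1) ≳ n ^ (1 / (2 k)) log n` for `k = k_n^α(ℓ_∞)`
    (∃ c : ℝ, 0 < c ∧ ∀ n : ℕ, 2 ≤ n → ∀ α : ℝ, 1 ≤ α →
      c * ((n : ℝ) ^ (1 / (2 * (dimReductionModulus EllInfty n α : ℝ))) * Real.log n)
        ≤ α * Real.log ((dimReductionModulus EllInfty n α : ℝ) + 1)) ∧
    -- the lower bound on `k_n^α(ℓ_∞)` for all `α ≥ 2`
    (∃ c κ : ℝ, 0 < c ∧ 0 < κ ∧ ∀ n : ℕ, 20 ≤ n → ∀ α : ℝ, 2 ≤ α →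
      κ * ((n : ℝ) ^ (c / α) +
          Real.log n /
            Real.log (Real.log n / α + α * Real.log (Real.log n) / Real.log n))
        ≤ (dimReductionModulus EllInfty n α : ℝ)) ∧
    -- the case in which `α` is of order `log n`
    (∀ a b : ℝ, 0 < a → a ≤ b → ∃ κ : ℝ, 0 < κ ∧ ∀ n : ℕ, 20 ≤ n → ∀ α : ℝ, 1 ≤ α →
      a * Real.log n ≤ α → α ≤ b * Real.log n →
      κ * (Real.log n / Real.log (Real.log (Real.log n)))
        ≤ (dimReductionModulus EllInfty n α : ℝ)) := by
  obtain ⟨c, hc, hmain⟩ := exists_const_rpow_mul_log_le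
  obtain ⟨κ, hκ, hsecond⟩ := exists_const_div_log_le hc
  have hpos : ∀ n : ℕ, 20 ≤ n → ∀ α : ℝ, 1 ≤ α → (1 : ℝ) ≤ dimReductionModulus EllInfty n α := by
    intro n hn α hα
    exact_mod_cast (hasDimReduction_dimReductionModulus (n := n) hα).pos (by omega)
  have hdiv : ∀ n : ℕ, 20 ≤ n → ∀ α : ℝ, 1 ≤ α →
      κ * (Real.log n / Real.log (Real.log n / α + α * Real.log (Real.log n) / Real.log n))
        ≤ (dimReductionModulus EllInfty n α : ℝ) := by
    intro n hn α hα
    refine hsecond _ α _ (log_ge_of_twenty_le hn) (by linarith) (hpos n hn α hα) ?_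
    have hn0 : (0 : ℝ) < n := by exact_mod_cast (by omega : 0 < n)
    have h := hmain n (by omega) α hα
    rwa [Real.rpow_def_of_pos hn0, mul_one_div] at h
  refine ⟨⟨c, hc, hmain⟩, ⟨c, min (1 / 4) (κ / 2), hc, by positivity, fun n hn α hα => ?_⟩,
    fun a b ha hab => ?_⟩
  · have hα1 : 1 ≤ α := by linarith
    have hn1 : (1 : ℝ) ≤ n := by exact_mod_cast (by omega : 1 ≤ n)
    have hk := hpos n hn α hα1
    have h1 := hdiv n hn α hα1
    have h2 : 1 / 2 * (n : ℝ) ^ (c / α) ≤ dimReductionModulus EllInfty n α := by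
      refine half_rpow_le_of_log_le (by linarith) (by linarith) hk ?_
      refine le_trans ?_ (hmain n (by omega) α hα1)
      refine mul_le_mul_of_nonneg_left ?_ hc.le
      exact le_mul_of_one_le_left (Real.log_nonneg hn1)
        (Real.one_le_rpow hn1 (by positivity))
    set k : ℝ := (dimReductionModulus EllInfty n α : ℝ)
    set D := Real.log n / Real.log (Real.log n / α + α * Real.log (Real.log n) / Real.log n)
    have hα0 : 0 < α := by linarith
    have hℓ := log_ge_of_twenty_le hn
    have hD : 0 ≤ D := by
      -- Used only for positivity of the denominator, with `a = b` tailored to the given `α`.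
      obtain ⟨K, -, hK⟩ := exists_const_log_le (a := α / Real.log n) (b := α / Real.log n)
        (by positivity) le_rfl
      have hcancel : α / Real.log n * Real.log n = α := by field_simp
      exact div_nonneg (by linarith) (hK _ α hℓ hcancel.le hcancel.ge).1.le
    have hP : 0 ≤ (n : ℝ) ^ (c / α) := by positivity
    calc min (1 / 4) (κ / 2) * ((n : ℝ) ^ (c / α) + D)
        = min (1 / 4) (κ / 2) * (n : ℝ) ^ (c / α) + min (1 / 4) (κ / 2) * D := by ring
      _ ≤ 1 / 4 * (n : ℝ) ^ (c / α) + κ / 2 * D := by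
          gcongr
          · exact min_le_left _ _
          · exact min_le_right _ _
      _ ≤ k := by linarith
  · obtain ⟨K, hK0, hK⟩ := exists_const_log_le ha hab
    refine ⟨κ / K, by positivity, fun n hn α hα h1 h2 => ?_⟩
    have hℓ := log_ge_of_twenty_le hn
    obtain ⟨hpos', hle⟩ := hK _ α hℓ h1 h2
    have hlll : 0 < Real.log (Real.log (Real.log n)) :=
      Real.log_pos (one_lt_log_eleven_div_four.trans_le (log_log_ge_of_twenty_le hn))
    refine le_trans ?_ (hdiv n hn α hα)
    calc κ / K * (Real.log n / Real.log (Real.log (Real.log n)))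
        = κ * (Real.log n / (K * Real.log (Real.log (Real.log n)))) := by field_simp
      _ ≤ _ := by gcongr
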